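/- For real \(x\) and an integer \(k\), let \(\binom{x}{k}=x(x-1)\cdots(x-k+1)/k!\) if \(k\ge 0\) and \(\binom{x}{k}=0\) if \(k<0\). Let \(\alpha>-1\), \(M\ge 0\), let \(P_n^{(\alpha,\alpha)}(x)=\sum_{k=0}^n\binom{n+2\alpha+k}{k}\binom{n+\alpha}{n-k}\left(\frac{x-1}{2}\right)^k\) be the classical Jacobi polynomials, and let, for \(n=0,1,2,\ldots\), \[P_n^{\alpha,\alpha,M,M}(x)=C_0P_n^{(\alpha,\alpha)}(x)-C_1x\frac{d}{dx}P_n^{(\alpha,\alpha)}(x)\] be the symmetric generalized Jacobi polynomials, where \[C_0=1+M\frac{2n}{\alpha+1}\binom{n+2\alpha+1}{n}+4M^2\binom{n+2\alpha+1}{n-1}^2,\] \[C_1=\frac{2M}{2\alpha+1}\binom{n+2\alpha}{n}+\frac{2M^2}{\alpha+1}\binom{n+2\alpha}{n-1}\binom{n+2\alpha+1}{n}\] (for \(\alpha=-\tfrac12\) and \(n\ge 1\) the first term of \(C_1\) is read as its limit \(2M/n\); for \(n=0\) the value of \(C_1\) is immaterial). Theorem. For every \(n=0,1,2,\ldots\)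 the polynomial \(y(x)=P_n^{\alpha,\alpha,M,M}(x)\) satisfies, for all real \(x\), \[M\sum_{i=0}^{\infty}c_i(x)y^{(i)}(x)+(1-x^2)y''(x)-2(\alpha+1)xy'(x)+n(n+2\alpha+1)y(x)=0,\] where the series converges, and the coefficients are \[c_0(x)=4(2\alpha+3)\binom{n+2\alpha+2}{n-2},\qquad c_i(x)=(2\alpha+3)(1-x^2)c_i^*(x)\quad(i=1,2,3,\ldots),\] with \(c_1^*(x)=0\) and \[c_i^*(x)=\frac{2^i}{i!}\sum_{k=0}^{i-2}\binom{\alpha+1}{i-k-2}\binom{i-2\alpha-5}{k}\left(\frac{1-x}{2}\right)^k\qquad(i=2,3,4,\ldots).\] In particular \(c_i\) does not depend on \(n\) for \(i\ge 1\). If \(\alpha\) is a nonnegative integer, then \(c_i=0\) for all \(i>2\alpha+4\), while \(c_{2\alpha+4}\) is not identically zero, so that the polynomials satisfy a linear differential equation of formal order \(2\alpha+4\) (that is, the sum may be taken over \(0\le i\le 2\alpha+4\); for \(M=0\) the true order is lower). -/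

import Mathlib

open Polynomial

noncomputable section

namespace SymJacobi

/-- The binomial coefficient `x.choose k` with real upper entry `x` and integer lower entry `k`:
`x (x - 1) ⋯ (x - k + 1) / k!` for `k ≥ 0`, and `0` for `k < 0`. -/
def binom (x : ℝ) (k : ℤ) : ℝ :=
  if 0 ≤ k then Ring.choose x k.toNat else 0

/-- The classical Jacobi polynomial `P_n^{(α,β)}`, normalised by `P_n^{(α,β)}(1) = binom (n + α) n`:
the coefficient of `((x - 1) / 2) ^ k` is `(n + α + β + 1)_k / k! * (α + k + 1)_{n - k} / (n - k)!`,
written here with binomial coefficients. -/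
def jacobi (α β : ℝ) (n : ℕ) : ℝ[X] :=
  ∑ k ∈ Finset.range (n + 1),
    C (binom (n + α + β + k) k * binom (n + α) ((n : ℤ) - k)) * (C (1 / 2) * (X - 1)) ^ k

/-- The coefficient `C₀` of the symmetric generalized Jacobi polynomial. -/
def C₀ (α M : ℝ) (n : ℕ) : ℝ :=
  1 + M * (2 * n / (α + 1)) * binom (n + 2 * α + 1) n
    + 4 * M ^ 2 * binom (n + 2 * α + 1) ((n : ℤ) - 1) ^ 2

/-- The coefficient `C₁` of the symmetric generalized Jacobi polynomial. In the first term
`2 M / (2 α + 1) * binom (n + 2 α) n` the factor `2 α + 1` cancels when `n ≥ 1`: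
`binom (n + 2 α) n / (2 α + 1) = (2 α + 2) (2 α + 3) ⋯ (2 α + n) / n!`, which is `1 / n` at
`α = - 1 / 2`, so that the term is read there as `2 M / n`.
(For `n = 0` the value of `C₁` is immaterial, as `C₁` multiplies the derivative of a constant.) -/
def C₁ (α M : ℝ) (n : ℕ) : ℝ :=
  (if 2 * α + 1 = 0 then 2 * M / n else 2 * M / (2 * α + 1) * binom (n + 2 * α) n)
    + 2 * M ^ 2 / (α + 1) * binom (n + 2 * α) ((n : ℤ) - 1) * binom (n + 2 * α + 1) n

/-- The symmetric generalized Jacobi polynomial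
`P_n^{α,α,M,M}(x) = C₀ P_n^{(α,α)}(x) - C₁ x (P_n^{(α,α)})'(x)`. -/
def genJacobi (α M : ℝ) (n : ℕ) : ℝ[X] :=
  C (C₀ α M n) * jacobi α α n - C (C₁ α M n) * X * derivative (jacobi α α n)

/-- `c_i^*(α, x)` (used for `i ≥ 1` only): `c_1^* = 0`, and for `i ≥ 2`
`c_i^*(α, x) = 2^i / i! * ∑_{k=0}^{i-2} binom (α+1) (i-k-2) * binom (i-2α-5) k * ((1-x)/2)^k`.
For `i ≤ 1` the index range is empty. -/
def cStar (α : ℝ) (i : ℕ) (x : ℝ) : ℝ :=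
  2 ^ i / (i.factorial : ℝ) *
    ∑ k ∈ Finset.range (i - 1),
      binom (α + 1) ((i : ℤ) - k - 2) * binom (i - 2 * α - 5) k * ((1 - x) / 2) ^ k

/-- The coefficient `c_i(α, x) = (2 α + 3) (1 - x²) c_i^*(α, x)` for `i ≥ 1`; it does not
depend on `n`. -/
def cPos (α : ℝ) (i : ℕ) (x : ℝ) : ℝ :=
  (2 * α + 3) * (1 - x ^ 2) * cStar α i x

/-- All coefficients: `c_0 = 4 (2 α + 3) binom (n + 2 α + 2) (n - 2)`, constant in `x`, and
`c_i = cPos α i` for `i ≥ 1`. -/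
def coeffDE (α : ℝ) (n i : ℕ) (x : ℝ) : ℝ :=
  if i = 0 then 4 * (2 * α + 3) * binom (n + 2 * α + 2) ((n : ℤ) - 2) else cPos α i x

end SymJacobi

end

/-! Substitute `t = (x - 1) / 2`. By Vandermonde's identity, `∑ i, c_i^* D^i` maps `p` to the
polynomial whose `t ^ r` coefficient is `binom (2 α + 4 + r) r` times the coefficient of
`t ^ (r + 2)` in the Laurent expansion of `(1 + 1 / t) ^ (α + 1) p`. For `p = P_n^{(α,α)}` the
Pfaff–Saalschütz identity evaluates the coefficients of `(1 + 1 / t) ^ α p` in closed form; they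
turn out to be multiples of those of `p` itself. Consequently `∑ i, c_i D^i` maps both `p` and
`x p'` to explicit multiples of `p''`. The Gegenbauer operator kills `p`, and its commutator with
`x D` is `2 D^2`, so it maps `x p'` to a multiple of `p''` as well. The equation for
`C₀ p - C₁ x p'` thus reduces to one scalar identity between `C₀` and `C₁`. -/

namespace SymJacobi

section BinomialRing

variable {R : Type*} [CommRing R] [BinomialRing R]

theorem choose_add_natCast (y : R) (k r : ℕ) :
    Ring.choose (y + k) (r + k)
      = ∑ l ∈ Finset.range (k + 1), (k.choose l : R) * Ring.choose y (r + l) := by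
  induction k generalizing r with
  | zero => simp
  | succ k ih =>
    rw [Finset.sum_choose_succ_mul (fun l _ => Ring.choose y (r + l)) k, Nat.cast_succ,
      ← add_assoc, ← add_assoc, Ring.choose_succ_succ, ih r, add_right_comm r k 1, ih (r + 1)]
    simp only [add_assoc, add_comm 1]

theorem sum_choose_mul_choose_mul_choose (a b : R) {N l : ℕ} (hl : l ≤ N) :
    ∑ k ∈ Finset.range (N + 1), (k.choose l : R) * (Ring.choose a k * Ring.choose b (N - k))
      = Ring.choose a l * Ring.choose (a + b - l) (N - l) := by
  obtain ⟨d, rfl⟩ := Nat.exists_eq_add_of_le hl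
  rw [show l + d + 1 = l + (d + 1) by ring, Finset.sum_range_add, Finset.sum_eq_zero, zero_add,
    add_sub_right_comm, Nat.add_sub_cancel_left, Ring.add_choose_eq d (Commute.all _ _),
    Finset.Nat.sum_antidiagonal_eq_sum_range_succ_mk, Finset.mul_sum]
  · refine Finset.sum_congr rfl fun j _ => ?_
    have h := Ring.choose_smul_choose a (Nat.le_add_right l j)
    rw [nsmul_eq_mul, Nat.add_sub_cancel_left] at h
    rw [← mul_assoc, h, mul_assoc, Nat.add_sub_add_left]
  · intro k hk
    rw [Nat.choose_eq_zero_of_lt (Finset.mem_range.mp hk), Nat.cast_zero, zero_mul]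

/-- The Pfaff–Saalschütz identity. -/
theorem sum_choose_mul_choose_mul_choose_add (a b : R) (N r : ℕ) :
    ∑ k ∈ Finset.range (N + 1),
        Ring.choose a k * Ring.choose b (N - k) * Ring.choose (a + b + r + k) (r + k)
      = Ring.choose (a + b + r) (N + r) * Ring.choose (a + N + r) N := by
  have expand : ∀ k ∈ Finset.range (N + 1), Ring.choose (a + b + r + k) (r + k)
      = ∑ l ∈ Finset.range (N + 1), (k.choose l : R) * Ring.choose (a + b + r) (r + l) := by
    intro k hk
    rw [choose_add_natCast]
    refine Finset.sum_subset (Finset.range_mono (Finset.mem_range.mp hk)) fun l _ hl => ?_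
    rw [Nat.choose_eq_zero_of_lt (by simpa using hl), Nat.cast_zero, zero_mul]
  have absorb : ∀ l ≤ N, Ring.choose (a + b + r) (r + l) * Ring.choose (a + b - l) (N - l)
      = ((N + r).choose (N - l) : R) * Ring.choose (a + b + r) (N + r) := by
    intro l hl
    have h := Ring.choose_smul_choose (a + b + r) (show r + l ≤ N + r by omega)
    rw [nsmul_eq_mul, show N + r - (r + l) = N - l by omega, Nat.cast_add,
      show a + b + r - ((r : R) + l) = a + b - l by ring] at h
    rw [← h, ← Nat.choose_symm (show r + l ≤ N + r by omega),
      show N + r - (r + l) = N - l by omega]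
  calc _ = ∑ k ∈ Finset.range (N + 1), ∑ l ∈ Finset.range (N + 1),
        Ring.choose (a + b + r) (r + l)
          * ((k.choose l : R) * (Ring.choose a k * Ring.choose b (N - k))) := by
        refine Finset.sum_congr rfl fun k hk => ?_
        rw [expand k hk, Finset.mul_sum]
        exact Finset.sum_congr rfl fun l _ => by ring
    _ = ∑ l ∈ Finset.range (N + 1), Ring.choose (a + b + r) (r + l)
          * (Ring.choose a l * Ring.choose (a + b - l) (N - l)) := by
        rw [Finset.sum_comm]
        refine Finset.sum_congr rfl fun l hl => ?_
        rw [← Finset.mul_sum, sum_choose_mul_choose_mul_choose a b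
          (Nat.lt_succ_iff.mp (Finset.mem_range.mp hl))]
    _ = Ring.choose (a + b + r) (N + r) * ∑ l ∈ Finset.range (N + 1),
          Ring.choose a l * ((N + r).choose (N - l) : R) := by
        rw [Finset.mul_sum]
        refine Finset.sum_congr rfl fun l hl => ?_
        linear_combination Ring.choose a l
          * absorb l (Nat.lt_succ_iff.mp (Finset.mem_range.mp hl))
    _ = _ := by
        have h := Ring.add_choose_eq N (Commute.all a ((N + r : ℕ) : R))
        rw [Finset.Nat.sum_antidiagonal_eq_sum_range_succ_mk] at h
        simp only [Ring.choose_natCast] at h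
        rw [← h, Nat.cast_add, ← add_assoc]

theorem choose_mul_choose_sub_comm (y : R) (n r : ℕ) :
    Ring.choose y n * Ring.choose (y - n) r = Ring.choose y r * Ring.choose (y - r) n := by
  have h₁ := Ring.choose_smul_choose y (Nat.le_add_right n r)
  have h₂ := Ring.choose_smul_choose y (Nat.le_add_left r n)
  rw [Nat.add_sub_cancel_left] at h₁
  rw [Nat.add_sub_cancel] at h₂
  rw [← h₁, ← h₂, Nat.choose_symm_add]

/-- Vandermonde's identity with the upper entry `-z` in one factor. -/
theorem sum_neg_one_pow_mul_choose_mul_choose (x z : R) (r : ℕ) :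
    ∑ k ∈ Finset.range (r + 1), (-1) ^ k * Ring.choose (z + k - 1) k * Ring.choose x (r - k)
      = Ring.choose (x - z) r := by
  rw [show x - z = -z + x by ring, Ring.add_choose_eq r (Commute.all _ _),
    Finset.Nat.sum_antidiagonal_eq_sum_range_succ_mk]
  refine Finset.sum_congr rfl fun k _ => ?_
  rw [Ring.choose_neg, Units.smul_def, zsmul_eq_mul, Int.negOnePow_def, zpow_natCast]
  push_cast
  rfl

end BinomialRing

theorem binom_natCast (x : ℝ) (k : ℕ) : binom x k = Ring.choose x k := by
  simp [binom]

theorem binom_of_neg (x : ℝ) {k : ℤ} (hk : k < 0) : binom x k = 0 := by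
  simp [binom, not_le.mpr hk]

theorem binom_zero (x : ℝ) : binom x 0 = 1 := by
  simp [binom]

theorem succ_mul_binom_succ (x : ℝ) (k : ℤ) :
    ((k : ℝ) + 1) * binom x (k + 1) = (x - k) * binom x k := by
  rcases lt_trichotomy k (-1) with h | h | h
  · rw [binom_of_neg x (by omega), binom_of_neg x (by omega)]; simp
  · subst h; simp [binom_of_neg]
  · lift k to ℕ using by omega
    have h' := Ring.choose_smul_choose x (Nat.le_succ k)
    rw [← Nat.cast_succ, binom_natCast, binom_natCast]
    simp only [Nat.succ_eq_add_one, Nat.choose_succ_self_right, Nat.add_sub_cancel_left,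
      Ring.choose_one_right, nsmul_eq_mul] at h'
    push_cast at h' ⊢
    rw [h']; ring

theorem binom_add_one (x : ℝ) (k : ℤ) :
    binom (x + 1) (k + 1) = binom x k + binom x (k + 1) := by
  rcases lt_trichotomy k (-1) with h | h | h
  · rw [binom_of_neg _ (by omega), binom_of_neg _ (by omega), binom_of_neg _ (by omega)]; simp
  · subst h; simp [binom_of_neg, binom_zero]
  · lift k to ℕ using by omega
    rw [← Nat.cast_succ, binom_natCast, binom_natCast, binom_natCast]
    exact Ring.choose_succ_succ x k

theorem succ_mul_binom_add_one (x : ℝ) (k : ℤ) :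
    ((k : ℝ) + 1) * binom (x + 1) (k + 1) = (x + 1) * binom x k := by
  rw [binom_add_one]
  linear_combination succ_mul_binom_succ x k

theorem sub_mul_binom_add_one (x : ℝ) (k : ℤ) :
    (x + 1 - k) * binom (x + 1) k = (x + 1) * binom x k := by
  obtain ⟨j, rfl⟩ : ∃ j, k = j + 1 := ⟨k - 1, by ring⟩
  rw [binom_add_one]
  push_cast
  linear_combination -succ_mul_binom_succ x j

@[fun_prop]
theorem continuous_binom {f : ℝ → ℝ} (hf : Continuous f) (k : ℤ) :
    Continuous fun x => binom (f x) k := by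
  rcases lt_or_ge k 0 with hk | hk
  · simpa only [binom_of_neg _ hk] using continuous_const
  lift k to ℕ using hk
  induction k with
  | zero => simpa only [Nat.cast_zero, binom_zero] using continuous_const
  | succ k ih =>
    have h : ∀ y, binom y (k + 1 : ℕ) = (y - k) * binom y k / (k + 1) := by
      intro y
      have := succ_mul_binom_succ y k
      push_cast at this ⊢
      rw [← this, mul_div_cancel_left₀ _ k.cast_add_one_ne_zero]
    simp only [h]
    fun_prop

/-- The coefficient of `X ^ r` in the Laurent expansion of `(1 + 1 / X) ^ β * p`. -/
noncomputable def twistCoeff (β : ℝ) (r : ℤ) : ℝ[X] →ₗ[ℝ] ℝ :=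
  lsum fun m => binom β (m - r) • LinearMap.id

theorem twistCoeff_monomial (β : ℝ) (r : ℤ) (m : ℕ) (c : ℝ) :
    twistCoeff β r (monomial m c) = binom β (m - r) * c := by
  simp [twistCoeff, lsum_apply, sum_monomial_index]

theorem twistCoeff_add_one (β : ℝ) (r : ℤ) (p : ℝ[X]) :
    twistCoeff (β + 1) r p = twistCoeff β r p + twistCoeff β (r + 1) p := by
  induction p using Polynomial.induction_on' with
  | add p q hp hq => simp only [map_add, hp, hq]; ring
  | monomial m c =>
    have h := binom_add_one β (m - r - 1)
    rw [sub_add_cancel] at h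
    rw [twistCoeff_monomial, twistCoeff_monomial, twistCoeff_monomial, h, ← sub_sub]
    ring

theorem twistCoeff_X_mul (β : ℝ) (r : ℤ) (p : ℝ[X]) :
    twistCoeff β (r + 1) (X * p) = twistCoeff β r p := by
  induction p using Polynomial.induction_on' with
  | add p q hp hq => rw [mul_add, map_add, map_add, hp, hq]
  | monomial m c =>
    rw [X_mul_monomial, twistCoeff_monomial, twistCoeff_monomial, Nat.cast_succ,
      add_sub_add_right_eq_sub]

theorem twistCoeff_X_mul_derivative (β : ℝ) (r : ℤ) (p : ℝ[X]) :
    twistCoeff (β + 1) r (X * derivative p)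
      = r * twistCoeff (β + 1) r p + (β + 1) * twistCoeff β (r + 1) p := by
  induction p using Polynomial.induction_on' with
  | add p q hp hq => simp only [map_add, mul_add, hp, hq]; ring
  | monomial m c =>
    have h := succ_mul_binom_add_one β (m - r - 1)
    rw [sub_add_cancel] at h
    push_cast at h
    have hX : X * derivative (monomial m c) = monomial m (c * m) := by
      cases m with
      | zero => simp
      | succ m => rw [derivative_monomial, X_mul_monomial, Nat.add_sub_cancel]
    rw [hX, twistCoeff_monomial, twistCoeff_monomial, twistCoeff_monomial, ← sub_sub]
    linear_combination c * h

/-- The operator `x d/dx` in the variable `t = (x - 1) / 2`, where `x = 2 t + 1` and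
`d/dx = (1 / 2) d/dt`. -/
noncomputable def eulerOp : ℝ[X] →ₗ[ℝ] ℝ[X] :=
  LinearMap.mulLeft ℝ (X + C (1 / 2)) ∘ₗ derivative

theorem eulerOp_apply (p : ℝ[X]) : eulerOp p = (X + C (1 / 2)) * derivative p := rfl

theorem twistCoeff_eulerOp (β : ℝ) (r : ℤ) (p : ℝ[X]) :
    twistCoeff (β + 1) r (eulerOp p)
      = r * twistCoeff β r p + (3 * r + 2 * β + 3) / 2 * twistCoeff β (r + 1) p
        + (r + β + 2) / 2 * twistCoeff β (r + 2) p := by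
  have h := twistCoeff_X_mul_derivative β (r + 1) p
  rw [twistCoeff_X_mul, twistCoeff_add_one β (r + 1), add_assoc r 1 1, one_add_one_eq_two] at h
  push_cast at h
  rw [eulerOp_apply, add_mul, ← smul_eq_C_mul, map_add, map_smul, smul_eq_mul, h,
    twistCoeff_X_mul_derivative, twistCoeff_add_one]
  ring

/-- The operator `∑ i, c_i^* D^i` in the variable `t = (x - 1) / 2`. -/
noncomputable def starOp (α : ℝ) : ℝ[X] →ₗ[ℝ] ℝ[X] :=
  lsum fun m => ∑ r ∈ Finset.range (m + 1),
    (binom (2 * α + 4 + r) r * binom (α + 1) (m - (r + 2))) • monomial r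

theorem starOp_monomial (α : ℝ) (m : ℕ) (c : ℝ) :
    starOp α (monomial m c) = ∑ r ∈ Finset.range (m + 1),
      monomial r (binom (2 * α + 4 + r) r * binom (α + 1) (m - (r + 2)) * c) := by
  simp [starOp, lsum_apply, sum_monomial_index, LinearMap.sum_apply, smul_monomial]

theorem coeff_starOp (α : ℝ) (p : ℝ[X]) (r : ℕ) :
    (starOp α p).coeff r = binom (2 * α + 4 + r) r * twistCoeff (α + 1) (r + 2) p := by
  induction p using Polynomial.induction_on' with
  | add p q hp hq => rw [map_add, map_add, coeff_add, hp, hq, mul_add]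
  | monomial m c =>
    rw [starOp_monomial, twistCoeff_monomial, finsetSum_coeff]
    simp only [coeff_monomial]
    rw [Finset.sum_ite_eq', ← mul_assoc, ite_eq_left_iff, Finset.mem_range]
    intro h
    rw [binom_of_neg (α + 1) (by omega), mul_zero, zero_mul]

theorem coeff_X_mul_one_add_X_mul_starOp (α : ℝ) (p : ℝ[X]) (r : ℕ) :
    (X * (1 + X) * starOp α p).coeff r
      = binom (2 * α + 3 + r) (r - 1) * twistCoeff (α + 1) (r + 1) p
        + binom (2 * α + 2 + r) (r - 2) * twistCoeff (α + 1) r p := by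
  rw [mul_assoc, add_mul, one_mul, mul_add]
  match r with
  | 0 => simp [binom_of_neg]
  | 1 =>
    rw [coeff_add, coeff_X_mul, coeff_X_mul, coeff_X_mul_zero, coeff_starOp]
    simp [binom_of_neg, binom_zero, one_add_one_eq_two]
  | r + 2 =>
    rw [coeff_add, coeff_X_mul, coeff_X_mul, coeff_X_mul, coeff_starOp, coeff_starOp]
    push_cast
    ring_nf

/-- The substitution `t = (x - 1) / 2`. -/
noncomputable def halfSubOne : ℝ[X] :=
  C (1 / 2) * (X - 1)

theorem eval_halfSubOne (x : ℝ) : halfSubOne.eval x = (x - 1) / 2 := by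
  simp [halfSubOne]; ring

theorem iterate_derivative_comp_halfSubOne (p : ℝ[X]) (i : ℕ) :
    derivative^[i] (p.comp halfSubOne) = C ((1 / 2) ^ i) * (derivative^[i] p).comp halfSubOne := by
  induction i with
  | zero => simp
  | succ i ih =>
    have h : derivative halfSubOne = C (1 / 2) := by simp [halfSubOne]
    rw [Function.iterate_succ_apply', ih, Function.iterate_succ_apply', derivative_C_mul,
      derivative_comp, h, ← mul_assoc, ← C_mul, ← pow_succ]

theorem eval_iterate_derivative_comp_halfSubOne (p : ℝ[X]) (i : ℕ) (x : ℝ) :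
    (derivative^[i] (p.comp halfSubOne)).eval x
      = (1 / 2) ^ i * (derivative^[i] p).eval ((x - 1) / 2) := by
  rw [iterate_derivative_comp_halfSubOne, eval_C_mul, eval_comp, eval_halfSubOne]

theorem cStar_eq (α : ℝ) (i : ℕ) (x : ℝ) :
    cStar α i x = 2 ^ i / (i.factorial : ℝ) *
      ∑ d ∈ Finset.range (i + 1), binom (α + 1) (d - 2) *
        ((-1) ^ (i - d) * binom (i - 2 * α - 5) (i - d : ℕ)) * ((x - 1) / 2) ^ (i - d) := by
  rw [cStar, ← Finset.sum_flip,
    ← Finset.sum_subset (Finset.range_mono (show i - 1 ≤ i + 1 by omega))]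
  · congr 1
    refine Finset.sum_congr rfl fun k hk => ?_
    rw [Finset.mem_range] at hk
    rw [show (1 - x) / 2 = (-1) * ((x - 1) / 2) by ring, mul_pow,
      Nat.sub_sub_self (show k ≤ i by omega), Nat.cast_sub (show k ≤ i by omega)]
    ring
  · intro k hk hk'
    rw [Finset.mem_range] at hk hk'
    rw [binom_of_neg (α + 1) (by omega), zero_mul, zero_mul]

theorem sum_choose_mul_binom (α : ℝ) (d r : ℕ) :
    ∑ k ∈ Finset.range (r + 1),
        ((d + r).choose (d + k) : ℝ) * ((-1) ^ k * binom ((d + k : ℕ) - 2 * α - 5) k)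
      = binom (2 * α + 4 + r) r := by
  have h := sum_neg_one_pow_mul_choose_mul_choose ((d + r : ℕ) : ℝ) (d - 2 * α - 4) r
  rw [show ((d + r : ℕ) : ℝ) - (d - 2 * α - 4) = 2 * α + 4 + r by push_cast; ring] at h
  rw [binom_natCast, ← h]
  refine Finset.sum_congr rfl fun k hk => ?_
  rw [Finset.mem_range] at hk
  rw [binom_natCast, Ring.choose_natCast, mul_comm,
    ← Nat.choose_symm (show d + k ≤ d + r by omega), Nat.add_sub_add_left,
    show ((d + k : ℕ) : ℝ) - 2 * α - 5 = d - 2 * α - 4 + k - 1 by push_cast; ring]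

theorem cStar_mul_eval_iterate_derivative_X_pow (α x : ℝ) (m i : ℕ) :
    cStar α i x * (derivative^[i] ((X ^ m : ℝ[X]).comp halfSubOne)).eval x
      = ∑ d ∈ Finset.range (i + 1), binom (α + 1) (d - 2) *
        ((m.choose (d + (i - d)) : ℝ)
          * ((-1) ^ (i - d) * binom ((d + (i - d) : ℕ) - 2 * α - 5) (i - d : ℕ)))
        * ((x - 1) / 2) ^ (m - d) := by
  rw [cStar_eq, eval_iterate_derivative_comp_halfSubOne, iterate_derivative_X_pow_eq_natCast_mul,
    eval_mul, eval_natCast, eval_pow, eval_X, Nat.descFactorial_eq_factorial_mul_choose,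
    Finset.mul_sum, Finset.sum_mul]
  refine Finset.sum_congr rfl fun d hd => ?_
  have hd' : d ≤ i := Nat.lt_succ_iff.mp (Finset.mem_range.mp hd)
  rw [Nat.add_sub_of_le hd']
  rcases le_or_gt i m with hi | hi
  · rw [show m - d = (i - d) + (m - i) by omega, pow_add, Nat.cast_mul, one_div, inv_pow]
    field_simp
  · simp [Nat.choose_eq_zero_of_lt hi]

theorem sum_cStar_mul_eval_iterate_derivative_X_pow (α x : ℝ) {m N : ℕ} (hm : m < N) :
    ∑ i ∈ Finset.range N,
        cStar α i x * (derivative^[i] ((X ^ m : ℝ[X]).comp halfSubOne)).eval x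
      = (starOp α (X ^ m)).eval ((x - 1) / 2) := by
  rw [← monomial_one_right_eq_X_pow, starOp_monomial, eval_finsetSum,
    monomial_one_right_eq_X_pow, ← Finset.sum_flip]
  have h := Finset.sum_subset (Finset.range_mono (show m + 1 ≤ N from hm))
    (f := fun i => cStar α i x * (derivative^[i] ((X ^ m : ℝ[X]).comp halfSubOne)).eval x) ?_
  · rw [← h]
    simp only [cStar_mul_eval_iterate_derivative_X_pow]
    rw [Finset.sum_range_diag_flip (m + 1) fun d k => binom (α + 1) (d - 2) *
        ((m.choose (d + k) : ℝ) * ((-1) ^ k * binom ((d + k : ℕ) - 2 * α - 5) k))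
          * ((x - 1) / 2) ^ (m - d)]
    refine Finset.sum_congr rfl fun d hd => ?_
    obtain ⟨r, rfl⟩ := Nat.exists_eq_add_of_le (Nat.lt_succ_iff.mp (Finset.mem_range.mp hd))
    rw [← Finset.sum_mul, ← Finset.mul_sum, show d + r + 1 - d = r + 1 by omega,
      sum_choose_mul_binom, eval_monomial, Nat.add_sub_cancel_left]
    push_cast
    rw [show (d : ℤ) + r - (r + 2) = d - 2 by ring]
    ring
  · intro i _ hi
    rw [eval_iterate_derivative_comp_halfSubOne,
      iterate_derivative_eq_zero (by simpa using hi), eval_zero, mul_zero, mul_zero]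

theorem sum_cStar_mul_eval_iterate_derivative (α x : ℝ) {p : ℝ[X]} {N : ℕ}
    (hp : p.natDegree < N) :
    ∑ i ∈ Finset.range N, cStar α i x * (derivative^[i] (p.comp halfSubOne)).eval x
      = (starOp α p).eval ((x - 1) / 2) := by
  refine induction_with_natDegree_le (fun p => ∑ i ∈ Finset.range N,
      cStar α i x * (derivative^[i] (p.comp halfSubOne)).eval x
        = (starOp α p).eval ((x - 1) / 2)) (N - 1) ?_ (fun m c _ hm => ?_)
    (fun f g _ _ hf hg => ?_) p (Nat.le_sub_one_of_lt hp)
  · simp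
  · rw [← smul_eq_C_mul, map_smul, eval_smul,
      ← sum_cStar_mul_eval_iterate_derivative_X_pow α x (show m < N by omega), Finset.smul_sum]
    simp only [smul_comp, iterate_derivative_smul, eval_smul, mul_smul_comm]
  · simp only [add_comp, iterate_map_add, eval_add, mul_add, Finset.sum_add_distrib, hf,
      hg, map_add]

/-- The coefficient of `((x - 1) / 2) ^ m` in `P_n^{(α,α)}`. -/
noncomputable def jacobiCoeff (α : ℝ) (n m : ℕ) : ℝ :=
  binom (n + 2 * α + m) m * binom (n + α) ((n : ℤ) - m)

theorem jacobiCoeff_eq_zero (α : ℝ) {n m : ℕ} (h : n < m) : jacobiCoeff α n m = 0 := by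
  rw [jacobiCoeff, binom_of_neg (n + α) (by omega), mul_zero]

theorem jacobiCoeff_succ (α : ℝ) (n m : ℕ) :
    ((m : ℝ) + 1) * (m + 1 + α) * jacobiCoeff α n (m + 1)
      = (n - m) * (n + 2 * α + 1 + m) * jacobiCoeff α n m := by
  have h₁ := succ_mul_binom_add_one (n + 2 * α + m) m
  have h₂ := succ_mul_binom_succ (n + α) ((n : ℤ) - m - 1)
  rw [jacobiCoeff, jacobiCoeff, Nat.cast_succ, Nat.cast_succ, ← add_assoc, ← sub_sub]
  rw [sub_add_cancel] at h₂
  push_cast at h₁ h₂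
  linear_combination (m + 1 + α) * binom (n + α) (n - m - 1) * h₁
    - (n + 2 * α + m + 1) * binom (n + 2 * α + m) m * h₂

/-- The Jacobi polynomial `P_n^{(α,α)}` in the variable `t = (x - 1) / 2`. -/
noncomputable def shiftedJacobi (α : ℝ) (n : ℕ) : ℝ[X] :=
  ∑ k ∈ Finset.range (n + 1), monomial k (jacobiCoeff α n k)

theorem coeff_shiftedJacobi (α : ℝ) (n k : ℕ) :
    (shiftedJacobi α n).coeff k = jacobiCoeff α n k := by
  simp only [shiftedJacobi, finsetSum_coeff, coeff_monomial]
  rw [Finset.sum_ite_eq', ite_eq_left_iff, Finset.mem_range]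
  exact fun h => (jacobiCoeff_eq_zero α (by omega)).symm

theorem jacobi_eq_comp (α : ℝ) (n : ℕ) : jacobi α α n = (shiftedJacobi α n).comp halfSubOne := by
  rw [shiftedJacobi, ← coe_compRingHom_apply, map_sum]
  refine Finset.sum_congr rfl fun k _ => ?_
  rw [coe_compRingHom_apply, monomial_comp, jacobiCoeff, halfSubOne,
    show (n : ℝ) + 2 * α + k = n + α + α + k by ring]

theorem twistCoeff_shiftedJacobi_eq_sum (α : ℝ) (n : ℕ) (r : ℤ) :
    twistCoeff α r (shiftedJacobi α n)
      = ∑ k ∈ Finset.range (n + 1), binom α (k - r) * jacobiCoeff α n k := by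
  simp only [shiftedJacobi, map_sum, twistCoeff_monomial]

theorem twistCoeff_shiftedJacobi (α : ℝ) (n r : ℕ) :
    twistCoeff α r (shiftedJacobi α n) = binom (n + 2 * α + r) n * binom (n + α) (n - r) := by
  rw [twistCoeff_shiftedJacobi_eq_sum]
  rcases lt_or_ge n r with h | h
  · rw [binom_of_neg (n + α) (by omega), mul_zero]
    refine Finset.sum_eq_zero fun k hk => ?_
    rw [binom_of_neg α (by have := Finset.mem_range.mp hk; omega), zero_mul]
  obtain ⟨N, rfl⟩ := Nat.exists_eq_add_of_le h
  have saalschuetz := sum_choose_mul_choose_mul_choose_add α ((r + N : ℕ) + α) N r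
  rw [show α + N + r = (r + N : ℕ) + α by push_cast; ring,
    show α + ((r + N : ℕ) + α) + r = (r + N : ℕ) + 2 * α + r by ring, add_comm N r,
    ← binom_natCast, ← binom_natCast] at saalschuetz
  rw [add_assoc, Finset.sum_range_add, Finset.sum_eq_zero, zero_add,
    show ((r + N : ℕ) : ℤ) - r = N by push_cast; ring, ← saalschuetz]
  · refine Finset.sum_congr rfl fun j hj => ?_
    have hj' : j ≤ N := Nat.lt_succ_iff.mp (Finset.mem_range.mp hj)
    rw [jacobiCoeff, show ((r + j : ℕ) : ℤ) - r = j by push_cast; ring,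
      show ((r + N : ℕ) : ℤ) - (r + j : ℕ) = (N - j : ℕ) by omega]
    simp only [binom_natCast]
    push_cast
    ring_nf
  · intro k hk
    rw [binom_of_neg α (by have := Finset.mem_range.mp hk; omega), zero_mul]

theorem binom_mul_twistCoeff_shiftedJacobi (α : ℝ) (n r : ℕ) :
    binom (2 * α + r) r * twistCoeff α r (shiftedJacobi α n)
      = binom (n + 2 * α) n * jacobiCoeff α n r := by
  have h := choose_mul_choose_sub_comm (n + 2 * α + r) n r
  rw [show (n : ℝ) + 2 * α + r - n = 2 * α + r by ring, add_sub_cancel_right] at h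
  simp only [← binom_natCast] at h
  rw [twistCoeff_shiftedJacobi, jacobiCoeff]
  linear_combination binom (n + α) (n - r) * h

/-- The constant `binom (n + 2 α) n / (2 α + 1) = (2 α + 2) ⋯ (2 α + n) / n!` for `n ≠ 0`, written
without division by `2 α + 1`. The constants `C₀`, `C₁` and `c_0` are expressed through it. -/
noncomputable def scale (α : ℝ) (n : ℕ) : ℝ :=
  binom (n + 2 * α) ((n : ℤ) - 1) / n

theorem natCast_mul_scale (α : ℝ) {n : ℕ} (hn : n ≠ 0) :
    n * scale α n = binom (n + 2 * α) ((n : ℤ) - 1) := by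
  have : (n : ℝ) ≠ 0 := by exact_mod_cast hn
  rw [scale]; field_simp

theorem binom_eq_scale (α : ℝ) {n : ℕ} (hn : n ≠ 0) :
    binom (n + 2 * α) n = (2 * α + 1) * scale α n := by
  have hn' : (n : ℝ) ≠ 0 := by exact_mod_cast hn
  have h₁ := natCast_mul_scale α hn
  have h₂ := succ_mul_binom_succ (n + 2 * α) ((n : ℤ) - 1)
  rw [sub_add_cancel] at h₂
  push_cast at h₂
  refine mul_left_cancel₀ hn' ?_
  linear_combination h₂ - (2 * α + 1) * h₁

theorem binom_add_one_eq_scale (α : ℝ) {n : ℕ} (hn : n ≠ 0) :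
    binom (n + 2 * α + 1) n = (n + 2 * α + 1) * scale α n := by
  have hn' : (n : ℝ) ≠ 0 := by exact_mod_cast hn
  have h₁ := natCast_mul_scale α hn
  have h₂ := succ_mul_binom_add_one (n + 2 * α) ((n : ℤ) - 1)
  rw [sub_add_cancel] at h₂
  push_cast at h₂
  refine mul_left_cancel₀ hn' ?_
  linear_combination h₂ - (n + 2 * α + 1) * h₁

theorem binom_add_one_pred_eq_scale (α : ℝ) {n : ℕ} (hn : n ≠ 0) :
    (2 * α + 2) * binom (n + 2 * α + 1) ((n : ℤ) - 1)
      = n * (n + 2 * α + 1) * scale α n := by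
  have h₁ := natCast_mul_scale α hn
  have h₂ := sub_mul_binom_add_one (n + 2 * α) ((n : ℤ) - 1)
  push_cast at h₂
  linear_combination h₂ - (n + 2 * α + 1) * h₁

theorem binom_add_two_eq_scale (α : ℝ) {n : ℕ} (hn : n ≠ 0) :
    (α + 1) * (α + 2) * (4 * (2 * α + 3) * binom (n + 2 * α + 2) ((n : ℤ) - 2))
      = n * (n - 1) * (n + 2 * α + 1) * (n + 2 * α + 2) * scale α n := by
  have h₁ := binom_add_one_pred_eq_scale α hn
  have h₂ := sub_mul_binom_add_one (n + 2 * α + 1) ((n : ℤ) - 1)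
  have h₃ := succ_mul_binom_succ (n + 2 * α + 2) ((n : ℤ) - 2)
  rw [show (n : ℤ) - 2 + 1 = n - 1 by ring] at h₃
  rw [show (n : ℝ) + 2 * α + 1 + 1 = n + 2 * α + 2 by ring] at h₂
  push_cast at h₂ h₃
  linear_combination -(α + 1) * (2 * (2 * α + 3)) * h₃ + 2 * (α + 1) * (n - 1) * h₂
    + (n - 1) * (n + 2 * α + 2) * h₁

/-- `∑ i, c_i D^i` (with `c_i` as in the differential equation) in the variable
`t = (x - 1) / 2`. -/
noncomputable def seriesOp (α : ℝ) (n : ℕ) : ℝ[X] →ₗ[ℝ] ℝ[X] :=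
  (4 * (2 * α + 3) * binom (n + 2 * α + 2) (n - 2)) • LinearMap.id
    - (4 * (2 * α + 3)) • LinearMap.mulLeft ℝ (X * (1 + X)) ∘ₗ starOp α

theorem seriesOp_apply (α : ℝ) (n : ℕ) (p : ℝ[X]) :
    seriesOp α n p = (4 * (2 * α + 3) * binom (n + 2 * α + 2) (n - 2)) • p
      - (4 * (2 * α + 3)) • (X * (1 + X) * starOp α p) := rfl

theorem coeff_seriesOp (α : ℝ) (n : ℕ) (p : ℝ[X]) (r : ℕ) :
    (seriesOp α n p).coeff r
      = 4 * (2 * α + 3) * binom (n + 2 * α + 2) (n - 2) * p.coeff r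
        - 4 * (2 * α + 3) * (binom (2 * α + 3 + r) (r - 1) * twistCoeff (α + 1) (r + 1) p
          + binom (2 * α + 2 + r) (r - 2) * twistCoeff (α + 1) r p) := by
  rw [seriesOp_apply, coeff_sub, coeff_smul, coeff_smul, coeff_X_mul_one_add_X_mul_starOp,
    smul_eq_mul, smul_eq_mul]

theorem mul_mul_coeff_seriesOp (α : ℝ) {n : ℕ} (hn : n ≠ 0) (p : ℝ[X]) (r : ℕ) :
    (α + 1) * (α + 2) * (seriesOp α n p).coeff r
      = n * (n - 1) * (n + 2 * α + 1) * (n + 2 * α + 2) * scale α n * p.coeff r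
        - r * (2 * (α + 1) * binom (2 * α + 2 + r) r)
          * ((r + 2 * α + 3) * twistCoeff (α + 1) (r + 1) p
            + (r - 1) * twistCoeff (α + 1) r p) := by
  have h₀ := binom_add_two_eq_scale α hn
  have h₁ := succ_mul_binom_succ (2 * α + 2 + r) (r - 1)
  have h₂ := succ_mul_binom_succ (2 * α + 2 + r) (r - 2)
  have h₃ := sub_mul_binom_add_one (2 * α + 2 + r) (r - 1)
  rw [show (2 * α + 2 + r + 1 : ℝ) = 2 * α + 3 + r by ring] at h₃
  rw [sub_add_cancel] at h₁
  rw [show (r : ℤ) - 2 + 1 = r - 1 by ring] at h₂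
  push_cast at h₁ h₂ h₃
  rw [coeff_seriesOp]
  linear_combination p.coeff r * h₀
    - 2 * (α + 1) * twistCoeff (α + 1) (r + 1) p * ((2 * α + 3) * h₃ - (2 * α + 3 + r) * h₁)
    + 2 * (α + 1) * twistCoeff (α + 1) r p * ((2 * α + 3) * h₂ + (r - 1) * h₁)

-- The binomial identities below are polynomial in `α`; this lemma removes the factors that they
-- pick up in their derivation and that vanish for exceptional `α`.
theorem eq_of_forall_sub_mul_eq {𝕜 : Type*} [NontriviallyNormedField 𝕜] {f g : 𝕜 → 𝕜}
    (hf : Continuous f) (hg : Continuous g) (c : 𝕜)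
    (h : ∀ x, (x - c) * f x = (x - c) * g x) : f = g :=
  hf.ext_on (dense_compl_singleton c) hg fun x hx => mul_left_cancel₀ (sub_ne_zero.mpr hx) (h x)

@[fun_prop]
theorem continuous_jacobiCoeff (n m : ℕ) : Continuous fun α => jacobiCoeff α n m := by
  unfold jacobiCoeff
  fun_prop

@[fun_prop]
theorem continuous_scale (n : ℕ) : Continuous fun α => scale α n := by
  unfold scale
  fun_prop

@[fun_prop]
theorem continuous_twistCoeff_shiftedJacobi (n : ℕ) (r : ℤ) :
    Continuous fun α => twistCoeff α r (shiftedJacobi α n) := by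
  simp only [twistCoeff_shiftedJacobi_eq_sum]
  fun_prop

theorem binom_mul_twistCoeff_eq_scale (α : ℝ) {n : ℕ} (hn : n ≠ 0) (r : ℕ) :
    2 * (α + 1) * binom (2 * α + 2 + r) r * twistCoeff α r (shiftedJacobi α n)
      = (r + 2 * α + 1) * (r + 2 * α + 2) * scale α n * jacobiCoeff α n r := by
  refine congrFun (eq_of_forall_sub_mul_eq (f := fun α =>
    2 * (α + 1) * binom (2 * α + 2 + r) r * twistCoeff α r (shiftedJacobi α n))
    (g := fun α => (r + 2 * α + 1) * (r + 2 * α + 2) * scale α n * jacobiCoeff α n r)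
    (by fun_prop) (by fun_prop) (-1 / 2) fun α => ?_) α
  have h₁ := binom_mul_twistCoeff_shiftedJacobi α n r
  have h₂ := sub_mul_binom_add_one (2 * α + r) r
  have h₃ := sub_mul_binom_add_one (2 * α + r + 1) r
  rw [show 2 * α + r + 1 + 1 = 2 * α + 2 + (r : ℝ) by ring] at h₃
  rw [binom_eq_scale α hn] at h₁
  push_cast at h₂ h₃
  linear_combination (r + 2 * α + 1) * (r + 2 * α + 2) / 2 * h₁
    + twistCoeff α r (shiftedJacobi α n) * ((2 * α + 1) / 2 * h₃ + (r + 2 * α + 2) / 2 * h₂)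

theorem succ_mul_binom_add_succ (x : ℝ) (r : ℕ) :
    ((r : ℝ) + 1) * binom (x + (r + 1 : ℕ)) (r + 1 : ℕ) = (x + r + 1) * binom (x + r) r := by
  have h := succ_mul_binom_add_one (x + r) r
  push_cast at h ⊢
  rw [← add_assoc, h]

theorem binom_mul_twistCoeff_succ_eq_scale (α : ℝ) {n : ℕ} (hn : n ≠ 0) (r : ℕ) :
    2 * (α + 1) * binom (2 * α + 2 + r) r * twistCoeff α (r + 1) (shiftedJacobi α n)
      = (r + 2 * α + 2) * (r + 1) * scale α n * jacobiCoeff α n (r + 1) := by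
  refine congrFun (eq_of_forall_sub_mul_eq (f := fun α =>
    2 * (α + 1) * binom (2 * α + 2 + r) r * twistCoeff α (r + 1) (shiftedJacobi α n))
    (g := fun α => (r + 2 * α + 2) * (r + 1) * scale α n * jacobiCoeff α n (r + 1))
    (by fun_prop) (by fun_prop) (-(r + 3) / 2) fun α => ?_) α
  have h₁ := binom_mul_twistCoeff_eq_scale α hn (r + 1)
  have h₂ := succ_mul_binom_add_succ (2 * α + 2) r
  push_cast at h₁ h₂ ⊢
  linear_combination (r + 1) / 2 * h₁
    - (α + 1) * twistCoeff α (r + 1) (shiftedJacobi α n) * h₂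

theorem binom_mul_twistCoeff_add_two_eq_scale (α : ℝ) {n : ℕ} (hn : n ≠ 0) (r : ℕ) :
    2 * (α + 1) * binom (2 * α + 2 + r) r * twistCoeff α (r + 2) (shiftedJacobi α n)
      = (r + 1) * (r + 2) * scale α n * jacobiCoeff α n (r + 2) := by
  refine congrFun (eq_of_forall_sub_mul_eq (f := fun α =>
    2 * (α + 1) * binom (2 * α + 2 + r) r * twistCoeff α (r + 2) (shiftedJacobi α n))
    (g := fun α => (r + 1) * (r + 2) * scale α n * jacobiCoeff α n (r + 2))
    (by fun_prop) (by fun_prop) (-(r + 3) / 2) fun α => ?_) α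
  have h₁ := binom_mul_twistCoeff_succ_eq_scale α hn (r + 1)
  have h₂ := succ_mul_binom_add_succ (2 * α + 2) r
  push_cast at h₁ h₂ ⊢
  rw [add_assoc (r : ℤ) 1 1, one_add_one_eq_two] at h₁
  linear_combination (r + 1) / 2 * h₁
    - (α + 1) * twistCoeff α (r + 2) (shiftedJacobi α n) * h₂

theorem binom_mul_twistCoeff_add_three_eq_scale (α : ℝ) {n : ℕ} (hn : n ≠ 0) (r : ℕ) :
    2 * (α + 1) * binom (2 * α + 2 + r) r
        * ((r + 2 * α + 3) * twistCoeff α (r + 3) (shiftedJacobi α n))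
      = (r + 1) * (r + 2) * (r + 3) * scale α n * jacobiCoeff α n (r + 3) := by
  have h₁ := binom_mul_twistCoeff_add_two_eq_scale α hn (r + 1)
  have h₂ := succ_mul_binom_add_succ (2 * α + 2) r
  push_cast at h₁ h₂ ⊢
  rw [add_assoc (r : ℤ) 1 2, show (1 : ℤ) + 2 = 3 by norm_num] at h₁
  linear_combination (r + 1) * h₁
    - 2 * (α + 1) * twistCoeff α (r + 3) (shiftedJacobi α n) * h₂

theorem mul_mul_coeff_seriesOp_shiftedJacobi (α : ℝ) {n : ℕ} (hn : n ≠ 0) (r : ℕ) :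
    (α + 1) * (α + 2) * (seriesOp α n (shiftedJacobi α n)).coeff r
      = (α + 1) * (α + 2) * scale α n * ((r + 1) * (r + 2) * jacobiCoeff α n (r + 2)) := by
  have v₀ := binom_mul_twistCoeff_eq_scale α hn r
  have v₁ := binom_mul_twistCoeff_succ_eq_scale α hn r
  have v₂ := binom_mul_twistCoeff_add_two_eq_scale α hn r
  have r₀ := jacobiCoeff_succ α n r
  have r₁ := jacobiCoeff_succ α n (r + 1)
  push_cast at r₁
  rw [mul_mul_coeff_seriesOp α hn, coeff_shiftedJacobi, twistCoeff_add_one, twistCoeff_add_one,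
    add_assoc (r : ℤ) 1 1, one_add_one_eq_two]
  linear_combination -r * (r - 1) * v₀ - 2 * r * (r + α + 1) * v₁ - r * (r + 2 * α + 3) * v₂
    - scale α n * (r + 1) * (r + α + 1) * r₁
    - scale α n * ((n - r - 1) * (n + 2 * α + 2 + r) + 2 * r * (r + 2 * α + 2)) * r₀

theorem coeff_eulerOp (p : ℝ[X]) (r : ℕ) :
    (eulerOp p).coeff r = r * p.coeff r + (r + 1) / 2 * p.coeff (r + 1) := by
  rw [eulerOp_apply, add_mul, coeff_add, coeff_C_mul, coeff_derivative]
  cases r with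
  | zero => simp
  | succ r => rw [coeff_X_mul, coeff_derivative]; push_cast; ring

theorem mul_mul_coeff_seriesOp_eulerOp_shiftedJacobi (α : ℝ) {n : ℕ} (hn : n ≠ 0) (r : ℕ) :
    (α + 1) * (α + 2) * (seriesOp α n (eulerOp (shiftedJacobi α n))).coeff r
      = (α + 2) * (n * (n + 2 * α + 1) * scale α n / 2)
        * ((r + 1) * (r + 2) * jacobiCoeff α n (r + 2)) := by
  have v₀ := binom_mul_twistCoeff_eq_scale α hn r
  have v₁ := binom_mul_twistCoeff_succ_eq_scale α hn r
  have v₂ := binom_mul_twistCoeff_add_two_eq_scale α hn r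
  have v₃ := binom_mul_twistCoeff_add_three_eq_scale α hn r
  have r₀ := jacobiCoeff_succ α n r
  have r₁ := jacobiCoeff_succ α n (r + 1)
  have r₂ := jacobiCoeff_succ α n (r + 2)
  push_cast at r₁ r₂
  rw [mul_mul_coeff_seriesOp α hn, coeff_eulerOp, coeff_shiftedJacobi, coeff_shiftedJacobi,
    twistCoeff_eulerOp, twistCoeff_eulerOp, add_assoc (r : ℤ) 1 1, add_assoc (r : ℤ) 1 2,
    one_add_one_eq_two, show (1 : ℤ) + 2 = 3 by norm_num]
  push_cast
  linear_combination -r * (r * (r - 1) * v₀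
      + ((r + 2 * α + 3) * (r + 1) + (r - 1) * (3 * r + 2 * α + 3) / 2) * v₁
      + ((r + 2 * α + 3) * (3 * r + 2 * α + 6) / 2 + (r - 1) * (r + α + 2) / 2) * v₂
      + (r + α + 3) / 2 * v₃)
    - scale α n / 2 * (r * (r + 1) * (r + 2) * r₂
      + (r + 1) * (n * (n + 2 * α + 1) + r * (3 * r + 4 * α + 5)) * r₁
      + (2 * r * (n * (n + 2 * α + 1)) + 2 * r * (r - 1) * (r + 2 * α + 2)) * r₀)

theorem coeff_iterate_derivative_two {R : Type*} [CommSemiring R] (p : R[X]) (r : ℕ) :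
    (derivative^[2] p).coeff r = (r + 1) * (r + 2) * p.coeff (r + 2) := by
  rw [Function.iterate_succ_apply', Function.iterate_one, coeff_derivative, coeff_derivative]
  push_cast
  ring

theorem seriesOp_shiftedJacobi (α : ℝ) {n : ℕ} (hn : n ≠ 0) :
    seriesOp α n (shiftedJacobi α n) = scale α n • derivative^[2] (shiftedJacobi α n) := by
  have hcont : ∀ r, Continuous fun α => (seriesOp α n (shiftedJacobi α n)).coeff r := by
    intro r
    simp only [coeff_seriesOp, coeff_shiftedJacobi, twistCoeff_add_one]
    fun_prop
  ext r
  rw [coeff_smul, coeff_iterate_derivative_two, coeff_shiftedJacobi, smul_eq_mul]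
  refine congrFun (eq_of_forall_sub_mul_eq (f := fun α =>
    (seriesOp α n (shiftedJacobi α n)).coeff r)
    (g := fun α => scale α n * ((r + 1) * (r + 2) * jacobiCoeff α n (r + 2)))
    (hcont r) (by fun_prop) (-1) fun α => ?_) α
  refine congrFun (eq_of_forall_sub_mul_eq (f := fun α =>
    (α - -1) * (seriesOp α n (shiftedJacobi α n)).coeff r)
    (g := fun α => (α - -1) * (scale α n * ((r + 1) * (r + 2) * jacobiCoeff α n (r + 2))))
    (by fun_prop) (by fun_prop) (-2) fun α => ?_) α
  linear_combination mul_mul_coeff_seriesOp_shiftedJacobi α hn r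

theorem smul_seriesOp_eulerOp_shiftedJacobi (α : ℝ) {n : ℕ} (hn : n ≠ 0) :
    (α + 1) • seriesOp α n (eulerOp (shiftedJacobi α n))
      = (n * (n + 2 * α + 1) * scale α n / 2) • derivative^[2] (shiftedJacobi α n) := by
  have hcont : ∀ r, Continuous fun α => (seriesOp α n (eulerOp (shiftedJacobi α n))).coeff r := by
    intro r
    simp only [coeff_seriesOp, coeff_eulerOp, coeff_shiftedJacobi, twistCoeff_eulerOp]
    fun_prop
  ext r
  rw [coeff_smul, coeff_smul, coeff_iterate_derivative_two, coeff_shiftedJacobi, smul_eq_mul,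
    smul_eq_mul]
  refine congrFun (eq_of_forall_sub_mul_eq (f := fun α =>
    (α + 1) * (seriesOp α n (eulerOp (shiftedJacobi α n))).coeff r)
    (g := fun α => n * (n + 2 * α + 1) * scale α n / 2
      * ((r + 1) * (r + 2) * jacobiCoeff α n (r + 2)))
    (by fun_prop) (by fun_prop) (-2) fun α => ?_) α
  linear_combination mul_mul_coeff_seriesOp_eulerOp_shiftedJacobi α hn r

/-- The Gegenbauer operator `(1 - x²) D² - 2 (α + 1) x D + n (n + 2 α + 1)` in the variable
`t = (x - 1) / 2`. -/
noncomputable def gegenbauerOp (α : ℝ) (n : ℕ) : ℝ[X] →ₗ[ℝ] ℝ[X] :=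
  (n * (n + 2 * α + 1) : ℝ) • LinearMap.id
    - LinearMap.mulLeft ℝ (X * (1 + X)) ∘ₗ derivative ∘ₗ derivative - (2 * (α + 1)) • eulerOp

theorem gegenbauerOp_apply (α : ℝ) (n : ℕ) (p : ℝ[X]) :
    gegenbauerOp α n p = (n * (n + 2 * α + 1) : ℝ) • p - X * (1 + X) * derivative^[2] p
      - (2 * (α + 1)) • eulerOp p := rfl

theorem gegenbauerOp_shiftedJacobi (α : ℝ) (n : ℕ) :
    gegenbauerOp α n (shiftedJacobi α n) = 0 := by
  have hdiff : ∀ (p : ℝ[X]) (r : ℕ), (X * (1 + X) * derivative^[2] p).coeff r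
      = r * (r - 1) * p.coeff r + (r + 1) * r * p.coeff (r + 1) := by
    intro p r
    rw [mul_assoc, add_mul, one_mul, mul_add, coeff_add]
    match r with
    | 0 => simp
    | 1 => rw [coeff_X_mul, coeff_X_mul, coeff_X_mul_zero, coeff_iterate_derivative_two]; norm_num
    | r + 2 =>
      rw [coeff_X_mul, coeff_X_mul, coeff_X_mul, coeff_iterate_derivative_two,
        coeff_iterate_derivative_two]
      push_cast
      ring
  ext r
  rw [gegenbauerOp_apply, coeff_sub, coeff_sub, coeff_smul, coeff_smul, hdiff, coeff_eulerOp,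
    coeff_shiftedJacobi, coeff_shiftedJacobi, coeff_zero, smul_eq_mul, smul_eq_mul]
  linear_combination -jacobiCoeff_succ α n r

theorem gegenbauerOp_eulerOp (α : ℝ) (n : ℕ) (p : ℝ[X]) :
    gegenbauerOp α n (eulerOp p)
      = eulerOp (gegenbauerOp α n p) + (1 / 2 : ℝ) • derivative^[2] p := by
  have h : (2 : ℝ[X]) * C (1 / 2) = 1 := by rw [← C_ofNat, ← C_mul]; norm_num
  simp only [gegenbauerOp_apply, eulerOp_apply, smul_eq_C_mul, Function.iterate_succ,
    Function.iterate_zero, Function.comp_apply, id, derivative_mul, derivative_add,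
    derivative_sub, derivative_X, derivative_C, derivative_one, derivative_zero]
  linear_combination X * derivative (derivative p) * h

theorem C₀_eq {α : ℝ} (hα : α ≠ -1) (M : ℝ) {n : ℕ} (hn : n ≠ 0) :
    C₀ α M n = (1 + M * (n * (n + 2 * α + 1) * scale α n / (α + 1))) ^ 2 := by
  have hα' : α + 1 ≠ 0 := mt eq_neg_of_add_eq_zero_left hα
  have h := binom_add_one_pred_eq_scale α hn
  have h' : binom (n + 2 * α + 1) ((n : ℤ) - 1)
      = n * (n + 2 * α + 1) * scale α n / (2 * (α + 1)) := by
    rw [← h]; field_simp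
  rw [C₀, binom_add_one_eq_scale α hn, h']
  field_simp
  ring

theorem C₁_eq {α : ℝ} (hα : α ≠ -1) (M : ℝ) {n : ℕ} (hn : n ≠ 0) :
    C₁ α M n = 2 * M * scale α n
      * (1 + M * (n * (n + 2 * α + 1) * scale α n / (α + 1))) := by
  have hα' : α + 1 ≠ 0 := mt eq_neg_of_add_eq_zero_left hα
  have hfirst : (if 2 * α + 1 = 0 then 2 * M / n
      else 2 * M / (2 * α + 1) * binom (n + 2 * α) n) = 2 * M * scale α n := by
    split_ifs with h
    · have hupper : (n : ℝ) + 2 * α = ((n - 1 : ℕ) : ℝ) := by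
        rw [Nat.cast_sub (by omega)]; push_cast; linarith
      have hlower : (n : ℤ) - 1 = ((n - 1 : ℕ) : ℤ) := by omega
      rw [scale, hupper, hlower, binom_natCast, Ring.choose_natCast, Nat.choose_self]
      push_cast
      ring
    · rw [binom_eq_scale α hn]
      field_simp
  rw [C₁, hfirst, binom_add_one_eq_scale α hn, ← natCast_mul_scale α hn]
  field_simp

/-- The generalized Jacobi polynomial `P_n^{α,α,M,M}` in the variable `t = (x - 1) / 2`. -/
noncomputable def shiftedGenJacobi (α M : ℝ) (n : ℕ) : ℝ[X] :=
  C₀ α M n • shiftedJacobi α n - C₁ α M n • eulerOp (shiftedJacobi α n)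

theorem genJacobi_eq_comp (α M : ℝ) (n : ℕ) :
    genJacobi α M n = (shiftedGenJacobi α M n).comp halfSubOne := by
  have h : (X + C (1 / 2) : ℝ[X]).comp halfSubOne = C (1 / 2) * X := by
    rw [add_comp, X_comp, C_comp, halfSubOne]; ring
  have hD := iterate_derivative_comp_halfSubOne (shiftedJacobi α n) 1
  rw [pow_one, Function.iterate_one] at hD
  rw [genJacobi, jacobi_eq_comp, hD, shiftedGenJacobi, sub_comp, smul_comp, smul_comp,
    eulerOp_apply, mul_comp, h, smul_eq_C_mul, smul_eq_C_mul]
  ring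

theorem smul_seriesOp_add_gegenbauerOp_shiftedGenJacobi {α : ℝ} (hα : α ≠ -1) (M : ℝ) (n : ℕ) :
    M • seriesOp α n (shiftedGenJacobi α M n) + gegenbauerOp α n (shiftedGenJacobi α M n) = 0 := by
  have hα' : α + 1 ≠ 0 := mt eq_neg_of_add_eq_zero_left hα
  rcases eq_or_ne n 0 with rfl | hn
  · have hstar : starOp α 1 = 0 := by
      ext r
      rw [coeff_starOp, ← monomial_zero_one, twistCoeff_monomial, binom_of_neg (α + 1) (by omega)]
      simp
    have heuler : eulerOp 1 = 0 := by rw [eulerOp_apply, derivative_one, mul_zero]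
    have hone : shiftedJacobi α 0 = 1 := by simp [shiftedJacobi, jacobiCoeff, binom_zero]
    simp [shiftedGenJacobi, hone, heuler, seriesOp_apply, hstar, gegenbauerOp_apply, binom_of_neg]
  have heuler : seriesOp α n (eulerOp (shiftedJacobi α n))
      = (n * (n + 2 * α + 1) * scale α n / (2 * (α + 1))) • derivative^[2] (shiftedJacobi α n) := by
    refine smul_right_injective _ hα' ?_
    dsimp only
    rw [smul_seriesOp_eulerOp_shiftedJacobi α hn, smul_smul]
    congr 1
    field_simp
  have hcoeff : M * (C₀ α M n * scale α n
      - C₁ α M n * (n * (n + 2 * α + 1) * scale α n / (2 * (α + 1)))) - C₁ α M n / 2 = 0 := by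
    rw [C₀_eq hα M hn, C₁_eq hα M hn]
    field_simp
    ring
  rw [shiftedGenJacobi]
  simp only [map_sub, map_smul]
  rw [seriesOp_shiftedJacobi α hn, heuler, gegenbauerOp_eulerOp, gegenbauerOp_shiftedJacobi,
    map_zero]
  linear_combination (norm := module) hcoeff • derivative^[2] (shiftedJacobi α n)

theorem eval_gegenbauerOp (α : ℝ) (n : ℕ) (p : ℝ[X]) (x : ℝ) :
    (gegenbauerOp α n p).eval ((x - 1) / 2)
      = (1 - x ^ 2) * (derivative^[2] (p.comp halfSubOne)).eval x
        - 2 * (α + 1) * x * (derivative (p.comp halfSubOne)).eval x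
        + n * (n + 2 * α + 1) * (p.comp halfSubOne).eval x := by
  have hD := eval_iterate_derivative_comp_halfSubOne p 1 x
  rw [Function.iterate_one] at hD
  rw [hD, eval_iterate_derivative_comp_halfSubOne, eval_comp, eval_halfSubOne,
    gegenbauerOp_apply, eulerOp_apply]
  simp only [eval_add, eval_sub, eval_mul, eval_smul, eval_X, eval_C, eval_one, smul_eq_mul]
  ring

theorem cPos_zero (α x : ℝ) : cPos α 0 x = 0 := by
  simp [cPos, cStar]

theorem sum_coeffDE_mul_eval_iterate_derivative (α : ℝ) (n : ℕ) (x : ℝ) {p : ℝ[X]} {N : ℕ}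
    (hp : p.natDegree < N) :
    ∑ i ∈ Finset.range N, coeffDE α n i x * (derivative^[i] (p.comp halfSubOne)).eval x
      = (seriesOp α n p).eval ((x - 1) / 2) := by
  have hsplit : ∀ i, coeffDE α n i x
      = (if i = 0 then 4 * (2 * α + 3) * binom (n + 2 * α + 2) (n - 2) else 0)
        + cPos α i x := by
    intro i
    rw [coeffDE]
    split_ifs with h
    · rw [h, cPos_zero, add_zero]
    · rw [zero_add]
  simp only [hsplit, add_mul, ite_mul, zero_mul, Finset.sum_add_distrib, cPos, mul_assoc]
  rw [Finset.sum_ite_eq', if_pos (Finset.mem_range.mpr (by omega))]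
  simp only [← Finset.mul_sum]
  rw [sum_cStar_mul_eval_iterate_derivative α x hp, seriesOp_apply]
  simp only [eval_add, eval_sub, eval_mul, eval_smul, eval_X, eval_one, smul_eq_mul,
    Function.iterate_zero, id, eval_comp, eval_halfSubOne]
  ring

theorem hasSum_coeffDE_mul_eval_iterate_derivative (α : ℝ) (n : ℕ) (p : ℝ[X]) (x : ℝ) :
    HasSum (fun i => coeffDE α n i x * (derivative^[i] (p.comp halfSubOne)).eval x)
      ((seriesOp α n p).eval ((x - 1) / 2)) := by
  rw [← sum_coeffDE_mul_eval_iterate_derivative α n x (Nat.lt_succ_self p.natDegree)]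
  refine hasSum_sum_of_ne_finset_zero fun i hi => ?_
  rw [eval_iterate_derivative_comp_halfSubOne,
    iterate_derivative_eq_zero (by simpa using hi), eval_zero, mul_zero, mul_zero]

theorem iteratedDeriv_eval {𝕜 : Type*} [NontriviallyNormedField 𝕜] (p : 𝕜[X]) (i : ℕ) (x : 𝕜) :
    iteratedDeriv i (fun t => p.eval t) x = (derivative^[i] p).eval x := by
  induction i generalizing x with
  | zero => simp
  | succ i ih =>
    rw [iteratedDeriv_succ, funext ih, Function.iterate_succ_apply']
    exact Polynomial.deriv _

theorem cPos_natCast_eq_zero (a : ℕ) {i : ℕ} (hi : 2 * a + 4 < i) (x : ℝ) :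
    cPos a i x = 0 := by
  have h : cStar a i x = 0 := by
    rw [cStar, Finset.sum_eq_zero, mul_zero]
    intro k _
    have hcast : (i : ℝ) - 2 * a - 5 = ((i - 2 * a - 5 : ℕ) : ℝ) := by
      rw [Nat.cast_sub (by omega), Nat.cast_sub (by omega)]; push_cast; ring
    rcases le_or_gt k (i - 2 * a - 5) with hk | hk
    · have hlower : (i : ℤ) - k - 2 = ((i - k - 2 : ℕ) : ℤ) := by omega
      have hsucc : (a : ℝ) + 1 = ((a + 1 : ℕ) : ℝ) := by push_cast; ring
      rw [hlower, hsucc, binom_natCast (a + 1 : ℕ), Ring.choose_natCast,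
        Nat.choose_eq_zero_of_lt (by omega)]
      simp
    · rw [hcast, binom_natCast (i - 2 * a - 5 : ℕ), Ring.choose_natCast,
        Nat.choose_eq_zero_of_lt hk]
      simp
  rw [cPos, h, mul_zero]

theorem binom_neg_one (k : ℕ) : binom (-1) k = (-1) ^ k := by
  induction k with
  | zero => simp [binom_zero]
  | succ k ih =>
    have h := succ_mul_binom_succ (-1) k
    have hk : (k : ℝ) + 1 ≠ 0 := by positivity
    refine mul_left_cancel₀ hk ?_
    push_cast at h ⊢
    rw [h, ih]
    ring

-- At `x = 3` the factor `((1 - x) / 2) ^ k` cancels the sign of `binom (-1) k`, so that no term of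
-- the sum is negative.
theorem cPos_natCast_three_ne_zero (a : ℕ) : cPos a (2 * a + 4) 3 ≠ 0 := by
  have hterm : ∀ k ∈ Finset.range (2 * a + 4 - 1),
      binom ((a : ℝ) + 1) (((2 * a + 4 : ℕ) : ℤ) - k - 2)
        * binom ((2 * a + 4 : ℕ) - 2 * a - 5) k * ((1 - 3) / 2) ^ k
      = ((a + 1).choose (2 * a + 2 - k) : ℝ) := by
    intro k hk
    have hk' := Finset.mem_range.mp hk
    have hlower : ((2 * a + 4 : ℕ) : ℤ) - k - 2 = ((2 * a + 2 - k : ℕ) : ℤ) := by omega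
    have hsucc : (a : ℝ) + 1 = ((a + 1 : ℕ) : ℝ) := by push_cast; ring
    have hupper : ((2 * a + 4 : ℕ) : ℝ) - 2 * a - 5 = -1 := by push_cast; ring
    rw [hlower, hsucc, hupper, binom_natCast (a + 1 : ℕ), Ring.choose_natCast, binom_neg_one,
      show (1 - 3) / 2 = (-1 : ℝ) by norm_num, mul_assoc, ← mul_pow]
    norm_num
  have hpos : 0 < ∑ k ∈ Finset.range (2 * a + 4 - 1),
      ((a + 1).choose (2 * a + 2 - k) : ℝ) := by
    refine Finset.sum_pos' (fun _ _ => Nat.cast_nonneg _)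
      ⟨2 * a + 2, Finset.mem_range.mpr (by omega), ?_⟩
    simp
  rw [cPos, cStar, Finset.sum_congr rfl hterm]
  refine mul_ne_zero (mul_ne_zero (by positivity) (by norm_num)) (mul_ne_zero ?_ hpos.ne')
  positivity

theorem hasSum_coeffDE_mul_iteratedDeriv_genJacobi (α M : ℝ) (n : ℕ) (x : ℝ) :
    HasSum (fun i => coeffDE α n i x * iteratedDeriv i (fun t => (genJacobi α M n).eval t) x)
      ((seriesOp α n (shiftedGenJacobi α M n)).eval ((x - 1) / 2)) := by
  simp only [iteratedDeriv_eval, genJacobi_eq_comp]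
  exact hasSum_coeffDE_mul_eval_iterate_derivative α n (shiftedGenJacobi α M n) x

theorem genJacobi_differential_equation {α : ℝ} (hα : α ≠ -1) (M : ℝ) (n : ℕ) (x : ℝ) :
    M * (∑' i : ℕ, coeffDE α n i x * iteratedDeriv i (fun t => (genJacobi α M n).eval t) x)
      + (1 - x ^ 2) * iteratedDeriv 2 (fun t => (genJacobi α M n).eval t) x
      - 2 * (α + 1) * x * deriv (fun t => (genJacobi α M n).eval t) x
      + n * (n + 2 * α + 1) * (genJacobi α M n).eval x = 0 := by
  have hop := congrArg (eval ((x - 1) / 2))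
    (smul_seriesOp_add_gegenbauerOp_shiftedGenJacobi hα M n)
  rw [eval_add, eval_smul, eval_gegenbauerOp, eval_zero, smul_eq_mul, ← genJacobi_eq_comp] at hop
  rw [(hasSum_coeffDE_mul_iteratedDeriv_genJacobi α M n x).tsum_eq, iteratedDeriv_eval,
    Polynomial.deriv]
  linear_combination hop

theorem sum_range_coeffDE_natCast_mul (a n : ℕ) (x : ℝ) (u : ℕ → ℝ) :
    ∑ i ∈ Finset.range (2 * a + 5), coeffDE a n i x * u i = ∑' i, coeffDE a n i x * u i := by
  refine (tsum_eq_sum fun i hi => ?_).symm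
  have hi' : 2 * a + 4 < i := not_le.mp fun h => hi (Finset.mem_range.mpr (Nat.lt_succ_of_le h))
  rw [coeffDE, if_neg (by omega), cPos_natCast_eq_zero a hi', zero_mul]

end SymJacobi

theorem theorem5_general (α M : ℝ) (hα : α ≠ -1) :
    (∀ (n : ℕ) (y : ℝ → ℝ), (y = fun t => (SymJacobi.genJacobi α M n).eval t) →
      ∀ x : ℝ,
        Summable (fun i : ℕ => SymJacobi.coeffDE α n i x * iteratedDeriv i y x) ∧
        M * (∑' i : ℕ, SymJacobi.coeffDE α n i x * iteratedDeriv i y x)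
          + (1 - x ^ 2) * iteratedDeriv 2 y x - 2 * (α + 1) * x * deriv y x
          + n * (n + 2 * α + 1) * y x = 0) ∧
    (∀ a : ℕ, α = a →
      (∀ i : ℕ, 2 * a + 4 < i → ∀ x : ℝ, SymJacobi.cPos α i x = 0) ∧
      (∃ x : ℝ, SymJacobi.cPos α (2 * a + 4) x ≠ 0) ∧
      (∀ (n : ℕ) (y : ℝ → ℝ), (y = fun t => (SymJacobi.genJacobi α M n).eval t) →
        ∀ x : ℝ,
          M * (∑ i ∈ Finset.range (2 * a + 5),
              SymJacobi.coeffDE α n i x * iteratedDeriv i y x)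
            + (1 - x ^ 2) * iteratedDeriv 2 y x - 2 * (α + 1) * x * deriv y x
            + n * (n + 2 * α + 1) * y x = 0)) := by
  refine ⟨?_, ?_⟩
  · rintro n _ rfl x
    exact ⟨(SymJacobi.hasSum_coeffDE_mul_iteratedDeriv_genJacobi α M n x).summable,
      SymJacobi.genJacobi_differential_equation hα M n x⟩
  · rintro a rfl
    refine ⟨fun i hi x => SymJacobi.cPos_natCast_eq_zero a hi x,
      ⟨3, SymJacobi.cPos_natCast_three_ne_zero a⟩, ?_⟩
    rintro n _ rfl x
    rw [SymJacobi.sum_range_coeffDE_natCast_mul]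
    exact SymJacobi.genJacobi_differential_equation hα M n x

theorem theorem5 (α M : ℝ) (hα : -1 < α) (hM : 0 ≤ M) :
    (∀ (n : ℕ) (y : ℝ → ℝ), (y = fun t => (SymJacobi.genJacobi α M n).eval t) →
      ∀ x : ℝ,
        Summable (fun i : ℕ => SymJacobi.coeffDE α n i x * iteratedDeriv i y x) ∧
        M * (∑' i : ℕ, SymJacobi.coeffDE α n i x * iteratedDeriv i y x)
          + (1 - x ^ 2) * iteratedDeriv 2 y x - 2 * (α + 1) * x * deriv y x
          + n * (n + 2 * α + 1) * y x = 0) ∧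
    (∀ a : ℕ, α = a →
      (∀ i : ℕ, 2 * a + 4 < i → ∀ x : ℝ, SymJacobi.cPos α i x = 0) ∧
      (∃ x : ℝ, SymJacobi.cPos α (2 * a + 4) x ≠ 0) ∧
      (∀ (n : ℕ) (y : ℝ → ℝ), (y = fun t => (SymJacobi.genJacobi α M n).eval t) →
        ∀ x : ℝ,
          M * (∑ i ∈ Finset.range (2 * a + 5),
              SymJacobi.coeffDE α n i x * iteratedDeriv i y x)
            + (1 - x ^ 2) * iteratedDeriv 2 y x - 2 * (α + 1) * x * deriv y x
            + n * (n + 2 * α + 1) * y x = 0)) :=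
  theorem5_general α M hα.ne'
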